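/- A numerical semigroup is a set $\Lambda\subseteq\mathbb{N}_0$ that contains $0$, is closed under addition, and has finite complement. Its multiplicity is $m(\Lambda)=\min(\Lambda\setminus\{0\})$, its conductor is $c(\Lambda)=\min\{c\in\mathbb{N}_0: c+\mathbb{N}_0\subseteq\Lambda\}$, and its depth is $q(\Lambda)=\lceil c(\Lambda)/m(\Lambda)\rceil$. For an integer $q\ge 2$ let $c_q=\sqrt{\lfloor (q+2)^2/4\rfloor}$, and let $\operatorname{Mult}_q(m)$ be the number of numerical semigroups with depth $q$ and multiplicity $m$ (a finite number for every $m$). For every fixed integer $q\ge 2$, $$\operatorname{Mult}_q(m)=c_q^{\,m+o(m)}\qquad(m\to\infty),$$ that is, there is a function $\varepsilon$ with $\varepsilon(m)/m\to 0$ as $m\to\infty$ such that $\operatorname{Mult}_q(m)=c_q^{\,m+\varepsilon(m)}$ for all sufficiently large $m$. -/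

import Mathlib

/-- A numerical semigroup: a submonoid of `(ℕ, +)` with finite complement. -/
structure NumericalSemigroup extends AddSubmonoid ℕ where
  finite_compl' : (carrierᶜ : Set ℕ).Finite

namespace NumericalSemigroup

/-- The multiplicity: the least nonzero element. -/
noncomputable def multiplicity (S : NumericalSemigroup) : ℕ :=
  sInf {n : ℕ | n ∈ S.toAddSubmonoid ∧ n ≠ 0}

/-- The conductor: the least `c` such that every integer `≥ c` lies in the semigroup. -/
noncomputable def conductor (S : NumericalSemigroup) : ℕ :=
  sInf {c : ℕ | ∀ n : ℕ, c + n ∈ S.toAddSubmonoid}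

/-- The depth: the conductor divided by the multiplicity, rounded up. -/
noncomputable def depth (S : NumericalSemigroup) : ℕ :=
  ⌈(S.conductor : ℚ) / (S.multiplicity : ℚ)⌉₊

end NumericalSemigroup

/-- The set of numerical semigroups with depth `q` and multiplicity `m`. -/
def depthMultSet (q m : ℕ) : Set NumericalSemigroup :=
  {S | S.depth = q ∧ S.multiplicity = m}

/-- The number of numerical semigroups with depth `q` and multiplicity `m`. -/
noncomputable def Mult (q m : ℕ) : ℕ :=
  (depthMultSet q m).ncard

/-- The constant `c_q = √⌊(q + 2)² / 4⌋`. -/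
noncomputable def cConst (q : ℕ) : ℝ :=
  Real.sqrt (⌊((q : ℝ) + 2) ^ 2 / 4⌋ : ℝ)

/-! ### Kunz coordinates of a semigroup -/

namespace NumericalSemigroup

/-! A semigroup of multiplicity m and depth at most q is its Kunz word w on ℤ/m: closure under
addition says w (i+j) ≤ w i + w j, with an extra 1 on the right when i+j wraps around m. Put C =
⌊(q+2)²/4⌋ = c_q²; about C^(m/2) words must be found.

Lower bound (`pow_le_mult`): letters in [⌈q/2⌉, q] on the lower half and in [⌊q/2⌋, q] on the upper
half can be chosen freely, giving C choices per pair of positions.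

Upper bound, by containers: if w k = r is the top letter, then v + i = k forces w v + w i ≥ r.
Ranges [l, r] and [l', r] with l + l' ≥ r have total size at most q + 2, hence product at most C.
`exists_dense_letter_window` finds D² such k, up to a small exceptional set; `exists_fingerprint`
records w at O(m/D) positions so that the resulting ranges satisfy l + l' ≥ r for nearly all pairs;
`prod_pow_le_of_sumGraph` averages over k. Each box then has at most c_q^m e^(O(m/D)) words, and
`card_sparse_le` bounds the fingerprints by e^(O(m log D / D)). With D fixed but large, the error is
e^(δm). -/

theorem exists_pos_mem (S : NumericalSemigroup) : ∃ n, n ∈ S.toAddSubmonoid ∧ n ≠ 0 := by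
  obtain ⟨n, hn⟩ := (S.finite_compl'.union (Set.finite_singleton 0)).exists_notMem
  simp only [Set.mem_union, Set.mem_compl_iff, Set.mem_singleton_iff, not_or, not_not] at hn
  exact ⟨n, hn⟩

theorem multiplicity_mem (S : NumericalSemigroup) : S.multiplicity ∈ S.toAddSubmonoid :=
  (Nat.sInf_mem (s := {n : ℕ | n ∈ S.toAddSubmonoid ∧ n ≠ 0}) S.exists_pos_mem).1

theorem multiplicity_ne_zero (S : NumericalSemigroup) : S.multiplicity ≠ 0 :=
  (Nat.sInf_mem (s := {n : ℕ | n ∈ S.toAddSubmonoid ∧ n ≠ 0}) S.exists_pos_mem).2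

theorem mem_of_conductor_le (S : NumericalSemigroup) {n : ℕ} (hn : S.conductor ≤ n) :
    n ∈ S.toAddSubmonoid := by
  have hne : {c : ℕ | ∀ n : ℕ, c + n ∈ S.toAddSubmonoid}.Nonempty := by
    obtain ⟨b, hb⟩ := S.finite_compl'.bddAbove
    refine ⟨b + 1, fun n => ?_⟩
    by_contra h
    have : b + 1 + n ≤ b := hb h
    omega
  have := Nat.sInf_mem hne (n - S.conductor)
  rwa [← conductor, Nat.add_sub_cancel' hn] at this

theorem conductor_le (S : NumericalSemigroup) : S.conductor ≤ S.depth * S.multiplicity := by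
  have hm : (0 : ℚ) < S.multiplicity := by exact_mod_cast Nat.pos_of_ne_zero S.multiplicity_ne_zero
  have h := Nat.le_ceil ((S.conductor : ℚ) / (S.multiplicity : ℚ))
  rw [div_le_iff₀ hm] at h
  exact_mod_cast h

/-- The Kunz coordinate at `i`: the least `a` with `a * m + i ∈ S`. -/
noncomputable def kunz (S : NumericalSemigroup) (m i : ℕ) : ℕ :=
  sInf {a : ℕ | a * m + i ∈ S.toAddSubmonoid}

theorem kunz_le {S : NumericalSemigroup} {m i a : ℕ} (h : a * m + i ∈ S.toAddSubmonoid) :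
    S.kunz m i ≤ a := Nat.sInf_le h

variable {q m : ℕ} {S : NumericalSemigroup}

theorem mul_add_mem (hS : S ∈ depthMultSet q m) (i : ℕ) : q * m + i ∈ S.toAddSubmonoid := by
  obtain ⟨rfl, rfl⟩ := hS
  exact S.mem_of_conductor_le (S.conductor_le.trans (Nat.le_add_right _ _))

theorem kunz_mul_add_mem (hS : S ∈ depthMultSet q m) (i : ℕ) :
    S.kunz m i * m + i ∈ S.toAddSubmonoid :=
  Nat.sInf_mem (s := {a : ℕ | a * m + i ∈ S.toAddSubmonoid}) ⟨q, mul_add_mem hS i⟩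

theorem kunz_le_depth (hS : S ∈ depthMultSet q m) (i : ℕ) : S.kunz m i ≤ q :=
  kunz_le (mul_add_mem hS i)

theorem mem_iff_kunz_le (hS : S ∈ depthMultSet q m) (n : ℕ) :
    n ∈ S.toAddSubmonoid ↔ S.kunz m (n % m) ≤ n / m := by
  refine ⟨fun h => kunz_le (by rwa [Nat.div_add_mod']), fun h => ?_⟩
  have hm : m ∈ S.toAddSubmonoid := hS.2 ▸ S.multiplicity_mem
  have := add_mem (S.toAddSubmonoid.nsmul_mem hm (n / m - S.kunz m (n % m)))
    (kunz_mul_add_mem hS (n % m))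
  rwa [smul_eq_mul, ← add_assoc, ← add_mul, Nat.sub_add_cancel h, Nat.div_add_mod'] at this

end NumericalSemigroup

/-- The words `w` over `{0, …, q}` satisfying the Kunz inequalities modulo `m`. -/
def KunzWords (q m : ℕ) : Set (Fin m → Fin (q + 1)) :=
  {w | ∀ i j k : Fin m,
    ((i : ℕ) + j = k → (w k : ℕ) ≤ w i + w j) ∧
    ((i : ℕ) + j = k + m → (w k : ℕ) ≤ w i + w j + 1)}

open NumericalSemigroup in
-- For an upper bound an injection suffices, so `KunzWords` need not remember w 0 = 0, positivity
-- elsewhere, or that the depth is exactly q.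
theorem exists_injOn_kunzWords (q m : ℕ) :
    ∃ f : NumericalSemigroup → (Fin m → Fin (q + 1)),
      Set.InjOn f (depthMultSet q m) ∧ Set.MapsTo f (depthMultSet q m) (KunzWords q m) := by
  have hval : ∀ S ∈ depthMultSet q m, ∀ i : ℕ, (Fin.ofNat (q + 1) (S.kunz m i) : ℕ) = S.kunz m i :=
    fun S hS i => by simpa using Nat.mod_eq_of_lt (Nat.lt_succ_of_le (kunz_le_depth hS i))
  refine ⟨fun S i => Fin.ofNat (q + 1) (S.kunz m i), fun S hS S' hS' h => ?_,
    fun S hS i j k => ⟨fun h => ?_, fun h => ?_⟩⟩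
  · have hm : 0 < m := hS.2 ▸ Nat.pos_of_ne_zero S.multiplicity_ne_zero
    have key : S.toAddSubmonoid = S'.toAddSubmonoid := by
      ext n
      rw [mem_iff_kunz_le hS, mem_iff_kunz_le hS']
      have := congrArg Fin.val (congrFun h ⟨n % m, Nat.mod_lt _ hm⟩)
      simp only [hval S hS, hval S' hS'] at this
      rw [this]
    cases S; cases S'; congr
  · simp only [hval S hS]
    apply kunz_le
    have := add_mem (kunz_mul_add_mem hS i) (kunz_mul_add_mem hS j)
    rw [← h]
    convert this using 1
    ring
  · simp only [hval S hS]
    apply kunz_le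
    have := add_mem (kunz_mul_add_mem hS i) (kunz_mul_add_mem hS j)
    convert this using 1
    linarith

theorem depthMultSet_finite (q m : ℕ) : (depthMultSet q m).Finite := by
  obtain ⟨f, hinj, -⟩ := exists_injOn_kunzWords q m
  exact Set.Finite.of_injOn (Set.mapsTo_univ f _) hinj Set.finite_univ

theorem mult_le_ncard_kunzWords (q m : ℕ) : Mult q m ≤ (KunzWords q m).ncard := by
  obtain ⟨f, hinj, hmaps⟩ := exists_injOn_kunzWords q m
  exact Set.ncard_le_ncard_of_injOn f hmaps hinj (Set.toFinite _)

/-! ### Semigroups from Kunz words -/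

/-- The semigroup with Kunz coordinates `w`. -/
def semigroupOfWord (m : ℕ) (hm : 0 < m) (w : ℕ → ℕ) (h0 : w 0 = 0)
    (hadd : ∀ i j, i < m → j < m → i + j < m → w (i + j) ≤ w i + w j)
    (hwrap : ∀ i j, i < m → j < m → m ≤ i + j → w (i + j - m) ≤ w i + w j + 1)
    (q : ℕ) (hq : ∀ i, i < m → w i ≤ q) : NumericalSemigroup where
  carrier := {n | w (n % m) ≤ n / m}
  zero_mem' := by simp [h0]
  add_mem' := by
    intro a b ha hb
    simp only [Set.mem_ofPred_eq] at *
    have h1 := Nat.mod_lt a hm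
    have h2 := Nat.mod_lt b hm
    rw [Nat.add_mod, Nat.add_div hm]
    by_cases h : a % m + b % m < m
    · rw [Nat.mod_eq_of_lt h, if_neg (by omega)]
      have := hadd _ _ h1 h2 h
      omega
    · rw [Nat.mod_eq_sub_mod (by omega), Nat.mod_eq_of_lt (a := a % m + b % m - m) (by omega),
        if_pos (by omega)]
      have := hwrap _ _ h1 h2 (by omega)
      omega
  finite_compl' := by
    refine (Set.finite_Iio (q * m)).subset fun n hn => ?_
    simp only [Set.mem_compl_iff, Set.mem_ofPred_eq, not_le] at hn
    exact (Nat.div_lt_iff_lt_mul hm).1 (hn.trans_le (hq _ (Nat.mod_lt _ hm)))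

section
variable {m : ℕ} {hm : 0 < m} {w : ℕ → ℕ} {h0 : w 0 = 0}
    {hadd : ∀ i j, i < m → j < m → i + j < m → w (i + j) ≤ w i + w j}
    {hwrap : ∀ i j, i < m → j < m → m ≤ i + j → w (i + j - m) ≤ w i + w j + 1}
    {q : ℕ} {hq : ∀ i, i < m → w i ≤ q}

theorem mem_semigroupOfWord {n : ℕ} :
    n ∈ (semigroupOfWord m hm w h0 hadd hwrap q hq).toAddSubmonoid ↔ w (n % m) ≤ n / m := Iff.rfl

/-- Positive letters exclude the nonzero numbers below m; the letter q at m - 1 makes q * m - 1 a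
gap, so the conductor is exactly q * m. -/
theorem semigroupOfWord_mem_depthMultSet (hpos : ∀ i, 0 < i → i < m → 0 < w i)
    (hlast : w (m - 1) = q) (hq0 : 0 < q) :
    semigroupOfWord m hm w h0 hadd hwrap q hq ∈ depthMultSet q m := by
  set S := semigroupOfWord m hm w h0 hadd hwrap q hq with hS
  have hmult : S.multiplicity = m := by
    refine le_antisymm (Nat.sInf_le ⟨?_, hm.ne'⟩) (le_csInf S.exists_pos_mem ?_)
    · rw [hS, mem_semigroupOfWord]; simp [h0]
    · rintro n ⟨hn, hn0⟩
      by_contra! hlt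
      rw [hS, mem_semigroupOfWord, Nat.mod_eq_of_lt hlt, Nat.div_eq_of_lt hlt] at hn
      have := hpos n (Nat.pos_of_ne_zero hn0) hlt
      omega
  have hcond : S.conductor = q * m := by
    refine le_antisymm (Nat.sInf_le fun n => ?_) ?_
    · rw [hS, mem_semigroupOfWord]
      refine (hq _ (Nat.mod_lt _ hm)).trans ((Nat.le_div_iff_mul_le hm).2 (Nat.le_add_right _ _))
    · by_contra! hlt
      have hmem : q * m - 1 ∈ S.toAddSubmonoid := S.mem_of_conductor_le (by omega)
      obtain ⟨p, rfl⟩ : ∃ p, q = p + 1 := ⟨q - 1, by omega⟩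
      have h1 : (p + 1) * m - 1 = (m - 1) + m * p := by
        obtain ⟨k, rfl⟩ : ∃ k, m = k + 1 := ⟨m - 1, by omega⟩
        rw [show (p + 1) * (k + 1) = k + (k + 1) * p + 1 by ring]; simp
      rw [hS, mem_semigroupOfWord, h1, Nat.add_mul_mod_self_left, Nat.add_mul_div_left _ _ hm,
        Nat.mod_eq_of_lt (by omega), Nat.div_eq_of_lt (by omega)] at hmem
      omega
  refine ⟨?_, hmult⟩
  have hm' : (m : ℚ) ≠ 0 := by exact_mod_cast hm.ne'
  rw [NumericalSemigroup.depth, hmult, hcond, Nat.cast_mul, mul_div_cancel_right₀ _ hm',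
    Nat.ceil_natCast]

theorem le_iff_mem_semigroupOfWord {i a : ℕ} (hi : i < m) :
    a * m + i ∈ (semigroupOfWord m hm w h0 hadd hwrap q hq).toAddSubmonoid ↔ w i ≤ a := by
  rw [mem_semigroupOfWord, add_comm, Nat.add_mul_mod_self_right, Nat.mod_eq_of_lt hi, Nat.add_mul_div_right _ _ hm,
    Nat.div_eq_of_lt hi, zero_add]

end

/-! ### The constant c_q -/

theorem mul_eq_add_two_sq_div_four (q : ℕ) : (q / 2 + 1) * (q - q / 2 + 1) = (q + 2) ^ 2 / 4 := by
  obtain ⟨k, rfl | rfl⟩ := Nat.even_or_odd' q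
  · have h1 : 2 * k / 2 = k := by omega
    have h2 : 2 * k - k = k := by omega
    rw [h1, h2, show (2 * k + 2) ^ 2 = 4 * ((k + 1) * (k + 1)) by ring]
    simp
  · have h1 : (2 * k + 1) / 2 = k := by omega
    have h2 : 2 * k + 1 - k = k + 1 := by omega
    rw [h1, h2, show (2 * k + 1 + 2) ^ 2 = 1 + 4 * ((k + 1) * (k + 1 + 1)) by ring]
    omega

theorem mul_le_add_two_sq_div_four {x y q : ℕ} (h : x + y ≤ q + 2) :
    x * y ≤ (q + 2) ^ 2 / 4 := by
  rw [Nat.le_div_iff_mul_le (by norm_num)]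
  have h1 : (x + y) ^ 2 ≤ (q + 2) ^ 2 := Nat.pow_le_pow_left h 2
  zify at *
  nlinarith [sq_nonneg ((x : ℤ) - y)]

theorem cConst_eq (q : ℕ) : cConst q = √(((q + 2) ^ 2 / 4 : ℕ) : ℝ) := by
  have : ⌊((q : ℝ) + 2) ^ 2 / 4⌋ = (((q + 2) ^ 2 / 4 : ℕ) : ℤ) := by
    have h := Nat.floor_div_eq_div (K := ℝ) ((q + 2) ^ 2) 4
    rw [← h, Int.natCast_floor_eq_floor (by positivity)]
    push_cast
    rfl
  rw [cConst, this, Int.cast_natCast]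

theorem two_le_cConst {q : ℕ} (hq : 2 ≤ q) : 2 ≤ cConst q := by
  rw [cConst_eq, Real.le_sqrt' (by norm_num)]
  have : 2 * 2 ≤ (q + 2) ^ 2 / 4 := mul_le_add_two_sq_div_four (by omega)
  norm_num at this
  exact_mod_cast this

theorem cConst_sq (q : ℕ) : cConst q ^ 2 = (((q + 2) ^ 2 / 4 : ℕ) : ℝ) := by
  rw [cConst_eq, Real.sq_sqrt (Nat.cast_nonneg _)]

/-! ### Lower bound -/

/-- Letters `q - f` on `[1, h]`, letters `q - g` on `[m - 1 - h, m - 2]`, and `q` elsewhere. -/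
def splitWord (q m h : ℕ) (f g : ℕ → ℕ) (i : ℕ) : ℕ :=
  if i = 0 then 0 else if i ≤ h then q - f (i - 1)
  else if m - 1 - h ≤ i ∧ i < m - 1 then q - g (i - (m - 1 - h)) else q

section splitWord
variable {q m h : ℕ} {f g : ℕ → ℕ}

theorem splitWord_le (i : ℕ) : splitWord q m h f g i ≤ q := by
  unfold splitWord; split_ifs <;> omega

theorem half_le_splitWord (hf : ∀ i, f i ≤ q / 2) (hg : ∀ i, g i ≤ q - q / 2) {i : ℕ}
    (hi : 0 < i) : q / 2 ≤ splitWord q m h f g i := by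
  have h1 := hf (i - 1)
  have h2 := hg (i - (m - 1 - h))
  unfold splitWord
  split_ifs <;> omega

theorem sub_half_le_splitWord (hh : 2 * h + 2 ≤ m) (hf : ∀ i, f i ≤ q / 2) {i : ℕ}
    (hi : 0 < i) (him : 2 * i < m) : q - q / 2 ≤ splitWord q m h f g i := by
  have h1 := hf (i - 1)
  unfold splitWord
  split_ifs <;> omega

end splitWord

/-- Positive i, j with i + j < m include one below m/2, so their letters sum to at least ⌈q/2⌉ +
⌊q/2⌋ = q; a wrapping pair has 2⌊q/2⌋ + 1 ≥ q. All Kunz inequalities are thus automatic. The bound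
on h keeps the two free blocks disjoint and away from 0 and m - 1. -/
theorem pow_le_mult {q m h : ℕ} (hq : 2 ≤ q) (hh : 2 * h + 2 ≤ m) :
    ((q + 2) ^ 2 / 4) ^ h ≤ Mult q m := by
  have hm : 0 < m := by omega
  let ext (n : ℕ) (f : Fin h → Fin (n + 1)) (i : ℕ) : ℕ := if hi : i < h then f ⟨i, hi⟩ else 0
  have hext : ∀ n f i, ext n f i ≤ n := by
    intro n f i
    simp only [ext]
    split_ifs <;> omega
  have hinj : ∀ n f f', (∀ i < h, ext n f i = ext n f' i) → f = f' := by
    intro n f f' H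
    funext i
    have := H i i.2
    simp only [ext, i.2, dif_pos] at this
    exact Fin.ext this
  let w (p : (Fin h → Fin (q / 2 + 1)) × (Fin h → Fin (q - q / 2 + 1))) : ℕ → ℕ :=
    splitWord q m h (ext _ p.1) (ext _ p.2)
  have hlow : ∀ p i, 0 < i → q / 2 ≤ w p i := fun p i hi =>
    half_le_splitWord (hext _ _) (hext _ _) hi
  have hlow' : ∀ p i, 0 < i → 2 * i < m → q - q / 2 ≤ w p i := fun p i hi him =>
    sub_half_le_splitWord hh (hext _ _) hi him
  have h0 : ∀ p, w p 0 = 0 := fun p => by simp [w, splitWord]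
  have hle : ∀ p i, w p i ≤ q := fun p i => splitWord_le i
  have hadd : ∀ p i j, i < m → j < m → i + j < m → w p (i + j) ≤ w p i + w p j := by
    intro p i j hi hj hij
    rcases Nat.eq_zero_or_pos i with rfl | hi0
    · simp
    rcases Nat.eq_zero_or_pos j with rfl | hj0
    · simp
    have h1 := hlow p i hi0
    have h2 := hlow p j hj0
    have h3 := hlow' p i hi0
    have h4 := hlow' p j hj0
    have h5 := hle p (i + j)
    omega
  have hwrap : ∀ p i j, i < m → j < m → m ≤ i + j → w p (i + j - m) ≤ w p i + w p j + 1 := by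
    intro p i j hi hj hij
    have h1 := hlow p i (by omega)
    have h2 := hlow p j (by omega)
    have h5 := hle p (i + j - m)
    omega
  let Φ p := semigroupOfWord m hm (w p) (h0 p) (hadd p) (hwrap p) q (fun i _ => hle p i)
  have hΦ : Function.Injective Φ := by
    intro p p' hpp
    have hw : ∀ i < m, w p i = w p' i := by
      intro i hi
      have key : ∀ a, w p i ≤ a ↔ w p' i ≤ a := by
        intro a
        have e1 := le_iff_mem_semigroupOfWord (hm := hm) (h0 := h0 p) (hadd := hadd p)
          (hwrap := hwrap p) (hq := fun i _ => hle p i) (a := a) hi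
        have e2 := le_iff_mem_semigroupOfWord (hm := hm) (h0 := h0 p') (hadd := hadd p')
          (hwrap := hwrap p') (hq := fun i _ => hle p' i) (a := a) hi
        rw [← e1, ← e2]
        change a * m + i ∈ (Φ p).toAddSubmonoid ↔ a * m + i ∈ (Φ p').toAddSubmonoid
        rw [hpp]
      exact le_antisymm ((key _).2 le_rfl) ((key _).1 le_rfl)
    refine Prod.ext (hinj _ _ _ fun i hi => ?_) (hinj _ _ _ fun i hi => ?_)
    · have := hw (i + 1) (by omega)
      simp only [w, splitWord, Nat.add_one_ne_zero, if_false, Nat.add_sub_cancel,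
        if_pos (show i + 1 ≤ h by omega)] at this
      have h1 := hext _ p.1 i
      have h2 := hext _ p'.1 i
      omega
    · have := hw (i + (m - 1 - h)) (by omega)
      simp only [w, splitWord, Nat.add_sub_cancel, if_neg (show ¬ i + (m - 1 - h) = 0 by omega),
        if_neg (show ¬ i + (m - 1 - h) ≤ h by omega),
        if_pos (show m - 1 - h ≤ i + (m - 1 - h) ∧ i + (m - 1 - h) < m - 1 by omega)] at this
      have h1 := hext _ p.2 i
      have h2 := hext _ p'.2 i
      omega
  have hmem : ∀ p, Φ p ∈ depthMultSet q m := by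
    intro p
    refine semigroupOfWord_mem_depthMultSet (fun i hi him => ?_) ?_ (by omega)
    · have := hlow p i hi
      omega
    · simp only [w, splitWord]
      split_ifs <;> omega
  calc ((q + 2) ^ 2 / 4) ^ h
      = Nat.card ((Fin h → Fin (q / 2 + 1)) × (Fin h → Fin (q - q / 2 + 1))) := by
        rw [← mul_eq_add_two_sq_div_four, mul_pow]
        simp
    _ = (Set.range Φ).ncard := by
        rw [← Set.image_univ, Set.ncard_image_of_injective _ hΦ, Set.ncard_univ]
    _ ≤ Mult q m := Set.ncard_le_ncard (Set.range_subset_iff.2 hmem) (depthMultSet_finite q m)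

theorem cConst_rpow_le_mult {q m : ℕ} (hq : 2 ≤ q) (hm : 2 ≤ m) :
    cConst q ^ ((m : ℝ) - 3) ≤ Mult q m := by
  have h1 := pow_le_mult (q := q) (m := m) (h := m / 2 - 1) hq (by omega)
  have h2 : cConst q ^ (2 * (m / 2 - 1)) ≤ (Mult q m : ℝ) := by
    rw [pow_mul, cConst_sq]
    exact_mod_cast h1
  refine le_trans ?_ h2
  rw [← Real.rpow_natCast]
  refine Real.rpow_le_rpow_of_exponent_le (by linarith [two_le_cConst hq]) ?_
  have : m ≤ 2 * (m / 2 - 1) + 3 := by omega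
  have : (m : ℝ) ≤ ((2 * (m / 2 - 1) : ℕ) : ℝ) + 3 := by exact_mod_cast this
  linarith

/-! ### Fingerprints in a graph with sum constraints -/

section Container

variable {V : Type*} (adj : V → V → Prop) [DecidableRel adj]

/-- The lower bound at `j` forced by the values of `w` on the neighbours of `j` in `F`, when
adjacent values at `i, j` must sum to at least `r j`. -/
def forcedBound (r w : V → ℕ) (F : Finset V) (j : V) : ℕ :=
  (F.filter (adj j)).sup fun i => r j - w i

variable {adj} {r w : V → ℕ}

theorem forcedBound_le_self {F : Finset V} {j : V} (h : ∀ i, adj j i → r j ≤ w j + w i) :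
    forcedBound adj r w F j ≤ w j := by
  refine Finset.sup_le fun i hi => ?_
  have := h i (Finset.mem_filter.1 hi).2
  omega

theorem forcedBound_le (F : Finset V) (j : V) : forcedBound adj r w F j ≤ r j :=
  Finset.sup_le fun _ _ => Nat.sub_le _ _

theorem forcedBound_mono {F F' : Finset V} (h : F ⊆ F') (j : V) :
    forcedBound adj r w F j ≤ forcedBound adj r w F' j :=
  Finset.sup_mono (Finset.filter_subset_filter _ h)

theorem le_forcedBound {F : Finset V} {i j : V} (hi : i ∈ F) (h : adj j i) :
    r j - w i ≤ forcedBound adj r w F j :=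
  Finset.le_sup (f := fun i => r j - w i) (Finset.mem_filter.2 ⟨hi, h⟩)

theorem forcedBound_congr {F : Finset V} {w' : V → ℕ} (h : ∀ i ∈ F, w i = w' i) :
    forcedBound adj r w F = forcedBound adj r w' F := by
  funext j
  exact Finset.sup_congr rfl fun i hi => by rw [h i (Finset.mem_filter.1 hi).1]

variable [Fintype V] [DecidableEq V]

/-- Take F largest with total forced bound at least D * |F|. A vertex violating the conclusion would
raise more than D forced bounds and could be added to F. The total never exceeds q * |V|, so F is
small. -/
theorem exists_fingerprint (hadj : ∀ v i, adj v i → adj i v) (w : V → ℕ) {q : ℕ} (hr : ∀ v, r v ≤ q) (D : ℕ) :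
    ∃ F : Finset V, D * F.card ≤ q * Fintype.card V ∧
      ∀ v, (Finset.univ.filter fun i => adj v i ∧ w v + forcedBound adj r w F i < r i).card ≤ D := by
  let P : Finset (Finset V) :=
    Finset.univ.filter fun F => D * F.card ≤ ∑ j, forcedBound adj r w F j
  have hP : P.Nonempty := ⟨∅, by simp [P]⟩
  obtain ⟨F, hF, hmax⟩ := P.exists_max_image Finset.card hP
  have hF' : D * F.card ≤ ∑ j, forcedBound adj r w F j := (Finset.mem_filter.1 hF).2
  refine ⟨F, hF'.trans ?_, fun v => ?_⟩
  · calc ∑ j, forcedBound adj r w F j ≤ ∑ _j : V, q :=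
          Finset.sum_le_sum fun j _ => (forcedBound_le F j).trans (hr j)
      _ = q * Fintype.card V := by simp [mul_comm]
  by_contra! hlt
  set N := Finset.univ.filter fun i => adj v i ∧ w v + forcedBound adj r w F i < r i with hN
  -- Were v in F, each neighbour's bound would already account for w v, leaving N empty.
  have hvF : v ∉ F := by
    intro hv
    obtain ⟨i, hi⟩ : N.Nonempty := Finset.card_pos.1 (by omega)
    obtain ⟨h1, h2⟩ := (Finset.mem_filter.1 hi).2
    have := le_forcedBound (r := r) (w := w) hv (hadj _ _ h1)
    omega
  have hins : insert v F ∈ P := by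
    refine Finset.mem_filter.2 ⟨Finset.mem_univ _, ?_⟩
    have hstep : ∀ j, forcedBound adj r w F j + (if j ∈ N then 1 else 0) ≤
        forcedBound adj r w (insert v F) j := by
      intro j
      split_ifs with hj
      · obtain ⟨h1, h2⟩ := (Finset.mem_filter.1 hj).2
        have := le_forcedBound (r := r) (w := w) (Finset.mem_insert_self v F) (hadj _ _ h1)
        omega
      · exact forcedBound_mono (Finset.subset_insert v F) j
    have := Finset.sum_le_sum fun j (_ : j ∈ Finset.univ) => hstep j
    rw [Finset.sum_add_distrib, Finset.sum_ite_mem, Finset.univ_inter, Finset.sum_const,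
      smul_eq_mul, mul_one] at this
    rw [Finset.card_insert_of_notMem hvF, mul_add]
    omega
  have := hmax _ hins
  rw [Finset.card_insert_of_notMem hvF] at this
  omega

end Container

/-! ### Averaging over a sum graph -/

section SumGraph

variable {G : Type*} [AddCommGroup G]

/-- The edges `v + i ∈ T` of a sum graph that avoid `B`. -/
def sumAdj (T B : Finset G) (v i : G) : Prop := v + i ∈ T ∧ v ∉ B ∧ i ∉ B

instance [DecidableEq G] (T B : Finset G) : DecidableRel (sumAdj T B) := fun _ _ => by
  unfold sumAdj; infer_instance

theorem sumAdj_symm (T B : Finset G) (v i : G) : sumAdj T B v i → sumAdj T B i v :=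
  fun ⟨h1, h2, h3⟩ => ⟨add_comm v i ▸ h1, h3, h2⟩

variable [Fintype G] [DecidableEq G]

/-- Since v ↦ k - v permutes G, the squared product is ∏ N v * N (k - v) for every k; multiply over
k in T. A factor exceeds C only if an endpoint lies in B or the pair is one of at most D bad ones at
v, and then costs at most Q². -/
theorem prod_pow_le_of_sumGraph (T B : Finset G) (N : G → ℕ) {Q C D : ℕ} (hQ : 1 ≤ Q) (hC : 1 ≤ C)
    (hN : ∀ v, N v ≤ Q)
    (hbad : ∀ v, v ∉ B →
      (Finset.univ.filter fun i => v + i ∈ T ∧ i ∉ B ∧ C < N v * N i).card ≤ D) :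
    (∏ v, N v) ^ (2 * T.card) ≤
      C ^ (Fintype.card G * T.card) *
        (Q ^ 2) ^ (2 * (T.card * B.card) + Fintype.card G * D) := by
  have hrefl : ∀ k : G, ∏ v, N (k - v) = ∏ v, N v := fun k =>
    Fintype.prod_equiv (Equiv.subLeft k) _ _ fun v => rfl
  let b (v k : G) : ℕ := (if v ∈ B then 1 else 0) + (if k - v ∈ B then 1 else 0) +
    (if v ∉ B ∧ k - v ∉ B ∧ C < N v * N (k - v) then 1 else 0)
  have hfactor : ∀ k v, N v * N (k - v) ≤ C * (Q ^ 2) ^ b v k := by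
    intro k v
    by_cases h : 1 ≤ b v k
    · calc N v * N (k - v) ≤ Q * Q := Nat.mul_le_mul (hN _) (hN _)
        _ = 1 * (Q ^ 2) ^ 1 := by ring
        _ ≤ C * (Q ^ 2) ^ b v k :=
          Nat.mul_le_mul hC (Nat.pow_le_pow_right (Nat.one_le_pow _ _ hQ) h)
    · have h1 : v ∉ B := fun hv => h (by simp only [b, if_pos hv]; omega)
      have h2 : k - v ∉ B := fun hv => h (by simp only [b, if_pos hv]; omega)
      have h3 : ¬ C < N v * N (k - v) := fun h3 =>
        h (by simp only [b, if_pos (show v ∉ B ∧ k - v ∉ B ∧ C < N v * N (k - v) from ⟨h1, h2, h3⟩)]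
              omega)
      exact (not_lt.1 h3).trans (Nat.le_mul_of_pos_right _ (by positivity))
  have hsum : ∑ k ∈ T, ∑ v, b v k ≤ 2 * (T.card * B.card) + Fintype.card G * D := by
    have e1 : ∑ _k ∈ T, ∑ v : G, (if v ∈ B then 1 else 0) = T.card * B.card := by simp
    have e2 : ∑ k ∈ T, ∑ v : G, (if k - v ∈ B then 1 else 0) = T.card * B.card := by
      rw [← e1]
      refine Finset.sum_congr rfl fun k _ => ?_
      exact Fintype.sum_equiv (Equiv.subLeft k) _ _ fun v => rfl
    have e3 : ∑ k ∈ T, ∑ v : G, (if v ∉ B ∧ k - v ∉ B ∧ C < N v * N (k - v) then 1 else 0) ≤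
        Fintype.card G * D := by
      rw [Finset.sum_comm]
      refine (Finset.sum_le_card_nsmul _ _ D fun v _ => ?_).trans (by simp)
      by_cases hv : v ∈ B
      · simp [hv]
      rw [← Finset.card_filter]
      refine le_trans (Finset.card_le_card_of_injOn (fun k => k - v) (fun k hk => ?_) ?_)
        (hbad v hv)
      · have := Finset.mem_filter.1 hk
        simpa [this.1] using this.2.2
      · exact fun a _ c _ h => sub_left_injective h
    simp only [b, Finset.sum_add_distrib]
    omega
  calc (∏ v, N v) ^ (2 * T.card) = ∏ k ∈ T, ∏ v, (N v * N (k - v)) := by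
        simp only [Finset.prod_mul_distrib, hrefl, Finset.prod_const, ← mul_pow]
        ring
    _ ≤ ∏ k ∈ T, ∏ v, (C * (Q ^ 2) ^ b v k) :=
        Finset.prod_le_prod' fun k _ => Finset.prod_le_prod' fun v _ => hfactor k v
    _ = C ^ (Fintype.card G * T.card) * (Q ^ 2) ^ ∑ k ∈ T, ∑ v, b v k := by
        simp only [Finset.prod_mul_distrib, Finset.prod_const, Finset.prod_pow_eq_pow_sum,
          Finset.card_univ, pow_mul]
    _ ≤ _ := Nat.mul_le_mul_left _ (Nat.pow_le_pow_right (Nat.one_le_pow _ _ hQ) hsum)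

/-- The letters still possible at `v` once `w` is known on the fingerprint `F`. -/
def allowedLetters (q D : ℕ) (r : G → ℕ) (T B F : Finset G) (w : G → ℕ) (v : G) :
    Finset (Fin (q + 1)) :=
  if v ∈ B then Finset.univ else Finset.univ.filter fun a =>
    (a : ℕ) ≤ r v ∧ forcedBound (sumAdj T B) r w F v ≤ a ∧
      (Finset.univ.filter fun i =>
        sumAdj T B v i ∧ a + forcedBound (sumAdj T B) r w F i < r i).card ≤ D

/-- Let a be the least allowed letter at v. For all but D neighbours i, a plus the forced bound at i
is at least r, so the two ranges have total size at most r + 2 ≤ q + 2. -/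
theorem prod_card_allowedLetters_pow_le {q D : ℕ} {r : G → ℕ} {T B : Finset G} (F : Finset G)
    (w : G → ℕ) (hr : ∀ v, r v ≤ q) (hrr : ∀ v i, sumAdj T B v i → r v = r i) :
    (∏ v, (allowedLetters q D r T B F w v).card) ^ (2 * T.card) ≤
      ((q + 2) ^ 2 / 4) ^ (Fintype.card G * T.card) *
        ((q + 1) ^ 2) ^ (2 * (T.card * B.card) + Fintype.card G * D) := by
  have hcard : ∀ v l, v ∉ B → (∀ a ∈ allowedLetters q D r T B F w v, l ≤ (a : ℕ)) →
      (allowedLetters q D r T B F w v).card ≤ r v + 1 - l := by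
    intro v l hv hl
    rw [← Nat.card_Icc]
    refine Finset.card_le_card_of_injOn (fun a => (a : ℕ)) (fun a ha => ?_)
      (Fin.val_injective.injOn)
    have h1 := hl a ha
    have h2 : (a : ℕ) ≤ r v := by
      have ha' : a ∈ allowedLetters q D r T B F w v := ha
      rw [allowedLetters, if_neg hv, Finset.mem_filter] at ha'
      exact ha'.2.1
    simp [h1, h2]
  refine prod_pow_le_of_sumGraph T B _ (by omega) ?_ (fun v => ?_) fun v hv => ?_
  · exact mul_le_add_two_sq_div_four (x := 1) (y := 1) (by omega)
  · exact (Finset.card_le_univ _).trans (by simp)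
  rcases (allowedLetters q D r T B F w v).eq_empty_or_nonempty with he | hne
  · simp [he]
  obtain ⟨a, ha, hmin⟩ := Finset.exists_min_image _ (fun a : Fin (q + 1) => (a : ℕ)) hne
  have ha' := ha
  rw [allowedLetters, if_neg hv, Finset.mem_filter] at ha'
  refine (Finset.card_le_card fun i hi => ?_).trans ha'.2.2.2
  simp only [Finset.mem_filter, Finset.mem_univ, true_and] at hi ⊢
  obtain ⟨h1, h2, h3⟩ := hi
  refine ⟨⟨h1, hv, h2⟩, ?_⟩
  by_contra! hge
  refine h3.not_ge ?_
  have c1 := hcard v a hv hmin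
  have c2 := hcard i (forcedBound (sumAdj T B) r w F i) h2 fun x hx => by
    rw [allowedLetters, if_neg h2, Finset.mem_filter] at hx
    exact hx.2.2.1
  have e := hrr v i ⟨h1, hv, h2⟩
  have hv' := hr v
  refine (Nat.mul_le_mul c1 c2).trans (mul_le_add_two_sq_div_four ?_)
  have f1 := ha'.2.1
  have f2 := forcedBound_le (adj := sumAdj T B) (r := r) (w := w) F i
  omega

end SumGraph

/-! ### A dense class of large letters -/

/-- The cap on letters outside the exceptional set: `κ / D` up to the window of index `κ % D`
(windows having length `L`), and one less beyond it. -/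
def letterCap (D L κ v : ℕ) : ℕ := if v / L ≤ κ % D then κ / D else κ / D - 1

theorem letterCap_le {D L κ q : ℕ} (h : κ < (q + 1) * D) (v : ℕ) : letterCap D L κ v ≤ q := by
  have : κ / D < q + 1 := Nat.div_lt_of_lt_mul (by rwa [mul_comm])
  unfold letterCap
  split_ifs <;> omega

theorem card_filter_div_eq_le (m j : ℕ) {L : ℕ} (hL : 0 < L) :
    (Finset.univ.filter fun v : Fin m => (v : ℕ) / L = j).card ≤ L := by
  refine (Finset.card_le_card_of_injOn (t := Finset.range L) (fun v : Fin m => (v : ℕ) % L)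
    (fun v _ => by simpa using Nat.mod_lt _ hL) fun a ha b hb h => ?_).trans_eq (Finset.card_range L)
  have ha' : (a : ℕ) / L = j := by simpa using ha
  have hb' : (b : ℕ) / L = j := by simpa using hb
  have h' : (a : ℕ) % L = b % L := h
  refine Fin.ext ?_
  rw [← Nat.div_add_mod (a : ℕ) L, ← Nat.div_add_mod (b : ℕ) L, ha', hb', h']

/-- Order positions lexicographically by (letter, window) and let κ be the largest class with at
least K members; T lies in it. Higher classes and the whole window of κ go into B. If v + i ∈ T does
not wrap, both summands lie in earlier windows; if it wraps, both lie in later ones, where the cap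
lower by one absorbs the extra 1 of the Kunz inequality. -/
theorem exists_dense_letter_window {q m D K : ℕ} [NeZero m] (hD : 0 < D)
    (hm : (q + 1) * D * K ≤ m) {w : Fin m → Fin (q + 1)} (hw : w ∈ KunzWords q m) :
    ∃ κ < (q + 1) * D, ∃ T B : Finset (Fin m), T.card = K ∧
      B.card ≤ (q + 1) * D * K + (m / D + 1) ∧
      (∀ v, v ∉ B → (w v : ℕ) ≤ letterCap D (m / D + 1) κ v) ∧
      ∀ v i, sumAdj T B v i →
        letterCap D (m / D + 1) κ v = letterCap D (m / D + 1) κ i ∧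
          letterCap D (m / D + 1) κ v ≤ w v + w i := by
  set L := m / D + 1 with hL
  have hmL : m < D * L := by
    rw [hL]
    exact Nat.lt_mul_div_succ m hD
  have hdiv : ∀ v : Fin m, (v : ℕ) / L < D := fun v =>
    Nat.div_lt_of_lt_mul (by rw [mul_comm]; exact v.2.trans hmL)
  let key (v : Fin m) : ℕ := (v : ℕ) / L + D * w v
  have hkdiv : ∀ v, key v / D = w v := fun v => by
    simp only [key]
    rw [Nat.add_mul_div_left _ _ hD, Nat.div_eq_of_lt (hdiv v), zero_add]
  have hkmod : ∀ v, key v % D = (v : ℕ) / L := fun v => by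
    simp only [key]
    rw [Nat.add_mul_mod_self_left, Nat.mod_eq_of_lt (hdiv v)]
  have hkey : ∀ v, key v < (q + 1) * D := fun v => by
    have h1 := hdiv v
    have h2 : D * (w v : ℕ) ≤ D * q := Nat.mul_le_mul_left _ (by omega)
    simp only [key]
    nlinarith
  let P := (Finset.range ((q + 1) * D)).filter fun κ =>
    K ≤ (Finset.univ.filter fun v => key v = κ).card
  have hP : P.Nonempty := by
    obtain ⟨κ, hκ, h⟩ := Finset.exists_le_card_fiber_of_mul_le_card_of_maps_to
      (s := (Finset.univ : Finset (Fin m))) (t := Finset.range ((q + 1) * D)) (f := key) (n := K)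
      (fun v _ => Finset.mem_range.2 (hkey v)) ⟨0, Finset.mem_range.2 (by positivity)⟩
      (by simpa using hm)
    exact ⟨κ, Finset.mem_filter.2 ⟨hκ, h⟩⟩
  obtain ⟨κ, hκP, hκmax⟩ := P.exists_max_image id hP
  obtain ⟨hκ, hκK⟩ := Finset.mem_filter.1 hκP
  obtain ⟨T, hT, hTK⟩ := Finset.exists_subset_card_eq hκK
  have hTkey : ∀ k ∈ T, key k = κ := fun k hk => (Finset.mem_filter.1 (hT hk)).2
  let E := Finset.univ.filter fun v => κ < key v
  have hE : E.card ≤ (q + 1) * D * K := by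
    rw [Finset.card_eq_sum_card_fiberwise (f := key) (t := Finset.range ((q + 1) * D))
      fun v _ => by simpa using hkey v]
    refine (Finset.sum_le_card_nsmul _ _ K fun κ' hκ' => ?_).trans (by simp)
    by_cases hlt : κ < κ'
    · by_contra! hgt
      have : κ' ∈ P := Finset.mem_filter.2 ⟨hκ', hgt.le.trans
        (Finset.card_le_card (Finset.filter_subset_filter _ (Finset.subset_univ _)))⟩
      have := hκmax _ this
      simp only [id] at this
      omega
    · rw [Finset.card_eq_zero.2]
      · exact Nat.zero_le _
      · refine Finset.filter_eq_empty_iff.2 fun v hv h => hlt ?_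
        exact h ▸ (Finset.mem_filter.1 hv).2
  let J := Finset.univ.filter fun v : Fin m => (v : ℕ) / L = κ % D
  refine ⟨κ, Finset.mem_range.1 hκ, T, E ∪ J, hTK, ?_, fun v hv => ?_, ?_⟩
  · exact (Finset.card_union_le _ _).trans
      (Nat.add_le_add hE (card_filter_div_eq_le m _ (Nat.succ_pos _)))
  · have hle : key v ≤ κ := by
      by_contra! h
      exact hv (Finset.mem_union_left _ (Finset.mem_filter.2 ⟨Finset.mem_univ _, h⟩))
    have h1 : (w v : ℕ) ≤ κ / D := hkdiv v ▸ Nat.div_le_div_right hle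
    unfold letterCap
    split_ifs with h
    · exact h1
    · rcases h1.lt_or_eq with h2 | h2
      · omega
      -- Beyond the window, the letter κ / D would give a key above κ.
      · exfalso
        have e1 := Nat.div_add_mod κ D
        simp only [key] at hle
        rw [h2] at hle
        omega
  · rintro v i ⟨hk, hv, hi⟩
    have hkk := hTkey _ hk
    have hvJ : (v : ℕ) / L ≠ κ % D := fun h =>
      hv (Finset.mem_union_right _ (Finset.mem_filter.2 ⟨Finset.mem_univ _, h⟩))
    have hiJ : (i : ℕ) / L ≠ κ % D := fun h =>
      hi (Finset.mem_union_right _ (Finset.mem_filter.2 ⟨Finset.mem_univ _, h⟩))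
    have hwk : (w (v + i) : ℕ) = κ / D := by rw [← hkdiv, hkk]
    have hpk : ((v + i : Fin m) : ℕ) / L = κ % D := by rw [← hkmod, hkk]
    have hval := Fin.val_add_eq_ite v i
    have hK := hw v i (v + i)
    unfold letterCap
    split_ifs at hval with hwrap
    · have h1 : κ % D ≤ (v : ℕ) / L := hpk ▸ Nat.div_le_div_right (by omega)
      have h2 : κ % D ≤ (i : ℕ) / L := hpk ▸ Nat.div_le_div_right (by omega)
      have := hK.2 (by omega)
      rw [if_neg (by omega), if_neg (by omega)]
      omega
    · have h1 : (v : ℕ) / L ≤ κ % D := hpk ▸ Nat.div_le_div_right (by omega)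
      have h2 : (i : ℕ) / L ≤ κ % D := hpk ▸ Nat.div_le_div_right (by omega)
      have := hK.1 (by omega)
      rw [if_pos h1, if_pos h2]
      omega

/-! ### Counting sparse functions and box sizes -/

/-- Give weight 1/D to each letter other than z and 1 to z. A counted g has weight at least
D^(-cn/D), while the total weight is at most (1 + |α|/D)^n. -/
theorem card_sparse_le {V α : Type*} [Fintype V] [DecidableEq V] [Fintype α] [DecidableEq α]
    (z : α) {D : ℕ} (hD : 0 < D) (c : ℕ) :
    ((Finset.univ.filter fun g : V → α =>
        D * (Finset.univ.filter fun v => g v ≠ z).card ≤ c * Fintype.card V).card : ℝ) ≤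
      Real.exp (Fintype.card V * ((c * Real.log D + Fintype.card α) / D)) := by
  set n := Fintype.card V with hn
  have hD0 : (0 : ℝ) < D := by exact_mod_cast hD
  have hD1 : (1 : ℝ) ≤ D := by exact_mod_cast hD
  have hlog : 0 ≤ Real.log D := Real.log_nonneg hD1
  let f (a : α) : ℝ := if a ≠ z then (D : ℝ)⁻¹ else 1
  have hf : ∀ a, 0 ≤ f a := fun a => by simp only [f]; split_ifs <;> positivity
  have hprod : ∀ g : V → α, ∏ v, f (g v) =
      Real.exp (-(Real.log D * (Finset.univ.filter fun v => g v ≠ z).card)) := by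
    intro g
    simp only [f]
    rw [Finset.prod_ite, Finset.prod_const, Finset.prod_const_one, mul_one, Real.exp_neg, mul_comm,
      Real.exp_nat_mul, Real.exp_log hD0, inv_pow]
  have hsum : ∑ a, f a ≤ Real.exp (Fintype.card α / D) := by
    calc ∑ a, f a ≤ ∑ a : α, ((D : ℝ)⁻¹ + if a = z then 1 else 0) := by
          refine Finset.sum_le_sum fun a _ => ?_
          simp only [f]
          split_ifs <;> simp_all
      _ = Fintype.card α / D + 1 := by
          rw [Finset.sum_add_distrib]; simp [div_eq_mul_inv]
      _ ≤ _ := Real.add_one_le_exp _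
  calc ((Finset.univ.filter fun g : V → α =>
        D * (Finset.univ.filter fun v => g v ≠ z).card ≤ c * n).card : ℝ)
      = ∑ g : V → α with D * (Finset.univ.filter fun v => g v ≠ z).card ≤ c * n, (1 : ℝ) := by
        simp
    _ ≤ ∑ g : V → α with D * (Finset.univ.filter fun v => g v ≠ z).card ≤ c * n,
          Real.exp (n * (c * Real.log D / D)) * ∏ v, f (g v) := by
        refine Finset.sum_le_sum fun g hg => ?_
        have h : ((D * (Finset.univ.filter fun v => g v ≠ z).card : ℕ) : ℝ) ≤ (c * n : ℕ) := by
          exact_mod_cast (Finset.mem_filter.1 hg).2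
        push_cast at h
        rw [hprod, ← Real.exp_add, Real.one_le_exp_iff]
        have : ((Finset.univ.filter fun v => g v ≠ z).card : ℝ) ≤ c * n / D := by
          rw [le_div_iff₀ hD0]; linarith
        have := mul_le_mul_of_nonneg_left this hlog
        have e : (n : ℝ) * (c * Real.log D / D) = Real.log D * (c * n / D) := by ring
        rw [e]
        linarith
    _ ≤ ∑ g : V → α, Real.exp (n * (c * Real.log D / D)) * ∏ v, f (g v) :=
        Finset.sum_le_sum_of_subset_of_nonneg (Finset.subset_univ _) fun g _ _ =>
          mul_nonneg (Real.exp_pos _).le (Finset.prod_nonneg fun v _ => hf _)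
    _ = Real.exp (n * (c * Real.log D / D)) * (∑ a, f a) ^ n := by
        rw [← Finset.mul_sum]
        congr 1
        have := Finset.prod_univ_sum (fun _ : V => (Finset.univ : Finset α)) fun _ a => f a
        rw [Fintype.piFinset_univ] at this
        rw [← this, Finset.prod_const, Finset.card_univ]
    _ ≤ Real.exp (n * (c * Real.log D / D)) * Real.exp (Fintype.card α / D) ^ n := by
        have : 0 ≤ ∑ a, f a := Finset.sum_nonneg fun a _ => hf a
        gcongr
    _ = _ := by
        rw [← Real.exp_nat_mul, ← Real.exp_add]
        congr 1
        ring

/-- With |T| = D², the error exponent is O(mD), so the 2D²-th root leaves e^(O(m/D)). -/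
theorem prod_card_allowedLetters_le {q m D : ℕ} [NeZero m] (hq : 2 ≤ q) (hD : 0 < D)
    {r : Fin m → ℕ} {T B : Finset (Fin m)} (F : Finset (Fin m)) (w : Fin m → ℕ)
    (hr : ∀ v, r v ≤ q) (hrr : ∀ v i, sumAdj T B v i → r v = r i) (hT : T.card = D ^ 2)
    (hB : D * B.card ≤ 2 * m) :
    ((∏ v, (allowedLetters q D r T B F w v).card : ℕ) : ℝ) ≤
      cConst q ^ m * Real.exp (m * (10 * Real.log (q + 1) / D)) := by
  have h := prod_card_allowedLetters_pow_le (D := D) F w hr hrr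
  rw [hT, Fintype.card_fin] at h
  have hc : 0 < cConst q := by linarith [two_le_cConst hq]
  have hD0 : (0 : ℝ) < D := by exact_mod_cast hD
  have hq0 : (0 : ℝ) < (q : ℝ) + 1 := by positivity
  have hexp : 2 * (2 * (D ^ 2 * B.card) + m * D) ≤ 10 * m * D := by
    nlinarith [Nat.mul_le_mul_left D hB]
  refine le_of_pow_le_pow_left₀ (n := 2 * D ^ 2) (by positivity) (by positivity) ?_
  have h' : ((∏ v, (allowedLetters q D r T B F w v).card : ℕ) : ℝ) ^ (2 * D ^ 2) ≤
      (((q + 2) ^ 2 / 4 : ℕ) : ℝ) ^ (m * D ^ 2) *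
        ((q + 1 : ℝ) ^ 2) ^ (2 * (D ^ 2 * B.card) + m * D) := by exact_mod_cast h
  refine h'.trans ?_
  rw [mul_pow, ← cConst_sq, ← pow_mul, ← pow_mul, ← pow_mul]
  refine mul_le_mul (le_of_eq (by ring)) ?_ (by positivity) (by positivity)
  calc (q + 1 : ℝ) ^ (2 * (2 * (D ^ 2 * B.card) + m * D)) ≤ (q + 1 : ℝ) ^ (10 * m * D) :=
        pow_le_pow_right₀ (by linarith [(Nat.cast_nonneg q : (0 : ℝ) ≤ q)]) hexp
    _ = Real.exp ((10 * m * D : ℕ) * Real.log (q + 1)) := by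
        rw [Real.exp_nat_mul, Real.exp_log hq0]
    _ ≤ Real.exp ((2 * D ^ 2 : ℕ) * (m * (10 * Real.log (q + 1) / D))) := by
        refine Real.exp_le_exp.2 ?_
        have hl : 0 ≤ Real.log ((q : ℝ) + 1) :=
          Real.log_nonneg (by linarith [(Nat.cast_nonneg q : (0 : ℝ) ≤ q)])
        have e : (((2 * D ^ 2 : ℕ) : ℝ) * (m * (10 * Real.log (q + 1) / D))) =
            20 * (m * D * Real.log (q + 1)) := by
          push_cast
          field_simp
          ring
        rw [e]
        push_cast
        have : 0 ≤ (m : ℝ) * D * Real.log (q + 1) := by positivity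
        linarith
    _ = _ := Real.exp_nat_mul _ _

/-! ### Encoding words by sparse data -/

section Fingerprint

variable {q m : ℕ}

/-- A fingerprint: partial values of a word together with two marked sets of positions. -/
abbrev Fingerprint (q m : ℕ) := Fin m → Option (Fin (q + 1)) × Bool × Bool

/-- The set of positions where the value is recorded. -/
def Fingerprint.known (g : Fingerprint q m) : Finset (Fin m) :=
  Finset.univ.filter fun v => (g v).1.isSome

/-- The recorded values. -/
def Fingerprint.value (g : Fingerprint q m) (v : Fin m) : ℕ := ((g v).1.getD 0 : Fin (q + 1))

/-- The first marked set. -/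
def Fingerprint.bad (g : Fingerprint q m) : Finset (Fin m) :=
  Finset.univ.filter fun v => (g v).2.1

/-- The second marked set. -/
def Fingerprint.target (g : Fingerprint q m) : Finset (Fin m) :=
  Finset.univ.filter fun v => (g v).2.2

/-- The fingerprint of `w` on `F` with marked sets `B` and `T`. -/
def fingerprintOf (w : Fin m → Fin (q + 1)) (F B T : Finset (Fin m)) : Fingerprint q m :=
  fun v => (if v ∈ F then some (w v) else none, decide (v ∈ B), decide (v ∈ T))

variable (w : Fin m → Fin (q + 1)) (F B T : Finset (Fin m))

theorem known_fingerprintOf : (fingerprintOf w F B T).known = F := by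
  ext v
  by_cases h : v ∈ F <;> simp [Fingerprint.known, fingerprintOf, h]

theorem bad_fingerprintOf : (fingerprintOf w F B T).bad = B := by
  ext v
  simp [Fingerprint.bad, fingerprintOf]

theorem target_fingerprintOf : (fingerprintOf w F B T).target = T := by
  ext v
  simp [Fingerprint.target, fingerprintOf]

theorem value_fingerprintOf {v : Fin m} (hv : v ∈ F) : (fingerprintOf w F B T).value v = w v := by
  simp [Fingerprint.value, fingerprintOf, hv]

theorem card_support_fingerprintOf_le :
    (Finset.univ.filter fun v => fingerprintOf w F B T v ≠ (none, false, false)).card ≤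
      F.card + B.card + T.card := by
  refine (Finset.card_le_card (t := F ∪ B ∪ T) fun v hv => ?_).trans
    ((Finset.card_union_le _ _).trans (Nat.add_le_add_right (Finset.card_union_le _ _) _))
  by_contra h
  simp only [Finset.mem_union, not_or] at h
  simp [fingerprintOf, h] at hv

/-- The words compatible with the cap `κ` and the fingerprint `g`. -/
def wordBox (D κ : ℕ) (g : Fingerprint q m) [NeZero m] : Finset (Fin m → Fin (q + 1)) :=
  Fintype.piFinset fun v =>
    allowedLetters q D (fun v : Fin m => letterCap D (m / D + 1) κ v) g.target g.bad g.known g.value v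

/-- The pairs of a cap index and a sparse fingerprint for which the box is small. -/
def sparseData (q m D : ℕ) [NeZero m] : Set (ℕ × Fingerprint q m) :=
  {p | p.1 < (q + 1) * D ∧
    D * (Finset.univ.filter fun v => p.2 v ≠ (none, false, false)).card ≤ (q + 3) * m ∧
    p.2.target.card = D ^ 2 ∧ D * p.2.bad.card ≤ 2 * m ∧
    ∀ v i, sumAdj p.2.target p.2.bad v i →
      letterCap D (m / D + 1) p.1 v = letterCap D (m / D + 1) p.1 i}

end Fingerprint

/-- The choice K = D² makes D bad neighbours negligible against |T|. The budget (q + 3) * m is q * m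
for F, 2 * m for B and m for T. -/
theorem exists_mem_wordBox {q m D : ℕ} [NeZero m] (hD : 0 < D) (hm : (q + 1) * D ^ 4 + D ≤ m)
    {w : Fin m → Fin (q + 1)} (hw : w ∈ KunzWords q m) :
    ∃ p ∈ sparseData q m D, w ∈ wordBox D p.1 p.2 := by
  have hD3 : D ^ 3 ≤ D ^ 4 := Nat.pow_le_pow_right hD (by norm_num)
  have hqD : (q + 1) * D ^ 3 ≤ (q + 1) * D ^ 4 := Nat.mul_le_mul_left _ hD3
  obtain ⟨κ, hκ, T, B, hT, hB, hcap, hadj⟩ := exists_dense_letter_window (K := D ^ 2) hD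
    (by calc (q + 1) * D * D ^ 2 = (q + 1) * D ^ 3 := by ring
          _ ≤ m := by omega) hw
  obtain ⟨F, hF, hfew⟩ := exists_fingerprint (sumAdj_symm T B) (fun v => (w v : ℕ))
    (r := fun v : Fin m => letterCap D (m / D + 1) κ v) (fun v => letterCap_le hκ v) D
  rw [Fintype.card_fin] at hF
  have hDB : D * B.card ≤ 2 * m := by
    calc D * B.card ≤ D * ((q + 1) * D * D ^ 2 + (m / D + 1)) := Nat.mul_le_mul_left _ hB
      _ = (q + 1) * D ^ 4 + D + D * (m / D) := by ring
      _ ≤ 2 * m := by have := Nat.mul_div_le m D; omega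
  refine ⟨(κ, fingerprintOf w F B T), ⟨hκ, ?_, ?_, ?_, ?_⟩, ?_⟩
  · calc _ ≤ D * (F.card + B.card + T.card) :=
          Nat.mul_le_mul_left _ (card_support_fingerprintOf_le w F B T)
      _ = D * F.card + D * B.card + D ^ 3 := by rw [hT]; ring
      _ ≤ q * m + 2 * m + m := by
          have : D ^ 3 ≤ (q + 1) * D ^ 3 := Nat.le_mul_of_pos_left _ (by omega)
          omega
      _ = (q + 3) * m := by ring
  · rw [target_fingerprintOf, hT]
  · rwa [bad_fingerprintOf]
  · rw [target_fingerprintOf, bad_fingerprintOf]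
    exact fun v i h => (hadj v i h).1
  · refine Fintype.mem_piFinset.2 fun v => ?_
    dsimp only
    rw [target_fingerprintOf, bad_fingerprintOf, known_fingerprintOf, allowedLetters,
      forcedBound_congr (F := F) fun i hi => value_fingerprintOf w F B T hi]
    split_ifs with hv
    · exact Finset.mem_univ _
    · exact Finset.mem_filter.2 ⟨Finset.mem_univ _, hcap v hv,
        forcedBound_le_self fun i hi => (hadj v i hi).2, hfew v⟩

theorem ncard_kunzWords_le {q m D : ℕ} (hq : 2 ≤ q) (hD : 0 < D) (hm : (q + 1) * D ^ 4 + D ≤ m) :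
    ((KunzWords q m).ncard : ℝ) ≤
      ((q + 1) * D : ℕ) * Real.exp (m * (((q + 3 : ℕ) * Real.log D + (4 * (q + 2) : ℕ)) / D)) *
        (cConst q ^ m * Real.exp (m * (10 * Real.log (q + 1) / D))) := by
  classical
  have : NeZero m := ⟨by omega⟩
  let sparse : Finset (Fingerprint q m) := Finset.univ.filter fun g =>
    D * (Finset.univ.filter fun v => g v ≠ (none, false, false)).card ≤
      (q + 3) * Fintype.card (Fin m)
  let data := (Finset.range ((q + 1) * D) ×ˢ sparse).filter (· ∈ sparseData q m D)
  have hsub : KunzWords q m ⊆ (data.biUnion fun p => wordBox D p.1 p.2 : Finset _) := by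
    intro w hw
    obtain ⟨p, hp, hwp⟩ := exists_mem_wordBox hD hm hw
    refine Finset.mem_coe.2 (Finset.mem_biUnion.2 ⟨p, ?_, hwp⟩)
    refine Finset.mem_filter.2 ⟨Finset.mem_product.2 ⟨Finset.mem_range.2 hp.1, ?_⟩, hp⟩
    refine Finset.mem_filter.2 ⟨Finset.mem_univ _, ?_⟩
    rw [Fintype.card_fin]
    exact hp.2.1
  have hbox : ∀ p ∈ data, ((wordBox D p.1 p.2).card : ℝ) ≤
      cConst q ^ m * Real.exp (m * (10 * Real.log (q + 1) / D)) := by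
    intro p hp
    obtain ⟨h1, -, h2, h3, h4⟩ := (Finset.mem_filter.1 hp).2
    rw [wordBox, Fintype.card_piFinset]
    exact prod_card_allowedLetters_le hq hD _ _ (fun v => letterCap_le h1 v) h4 h2 h3
  have hdata : (data.card : ℝ) ≤ ((q + 1) * D : ℕ) *
      Real.exp (m * (((q + 3 : ℕ) * Real.log D + (4 * (q + 2) : ℕ)) / D)) := by
    have h1 : (data.card : ℝ) ≤ ((q + 1) * D : ℕ) * (sparse.card : ℝ) := by
      have h : data.card ≤ (Finset.range ((q + 1) * D) ×ˢ sparse).card := Finset.card_filter_le _ _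
      rw [Finset.card_product, Finset.card_range] at h
      rw [← Nat.cast_mul]
      exact Nat.cast_le.2 h
    refine h1.trans (mul_le_mul_of_nonneg_left ?_ (Nat.cast_nonneg _))
    have h2 := card_sparse_le (V := Fin m) ((none, false, false) : Option (Fin (q + 1)) × Bool × Bool)
      hD (q + 3)
    have h3 : Fintype.card (Option (Fin (q + 1)) × Bool × Bool) = 4 * (q + 2) := by
      simp; ring
    rw [h3] at h2
    simpa only [sparse, Fintype.card_fin] using h2
  calc ((KunzWords q m).ncard : ℝ) ≤ ((data.biUnion fun p => wordBox D p.1 p.2).card : ℝ) := by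
        have := Set.ncard_le_ncard hsub (Finset.finite_toSet _)
        rw [Set.ncard_coe_finset] at this
        exact_mod_cast this
    _ ≤ ∑ p ∈ data, ((wordBox D p.1 p.2).card : ℝ) := by exact_mod_cast Finset.card_biUnion_le
    _ ≤ data.card * (cConst q ^ m * Real.exp (m * (10 * Real.log (q + 1) / D))) := by
        rw [← nsmul_eq_mul]
        exact Finset.sum_le_card_nsmul _ _ _ hbox
    _ ≤ _ := by
        have : 0 < cConst q := by linarith [two_le_cConst hq]
        gcongr

/-! ### Asymptotics -/

open Filter Topology in
theorem eventually_mult_le {q : ℕ} (hq : 2 ≤ q) {δ : ℝ} (hδ : 0 < δ) :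
    ∀ᶠ m : ℕ in atTop, (Mult q m : ℝ) ≤ cConst q ^ m * Real.exp (δ * m) := by
  have hlim : Tendsto (fun D : ℕ => ((q + 3 : ℕ) * Real.log D + (4 * (q + 2) : ℕ)) / (D : ℝ) +
      10 * Real.log (q + 1) / D) atTop (𝓝 0) := by
    have h1 : Tendsto (fun D : ℕ => Real.log D / (D : ℝ)) atTop (𝓝 0) := by
      have := Real.isLittleO_log_id_atTop.tendsto_div_nhds_zero
      exact this.comp tendsto_natCast_atTop_atTop
    have h2 := (tendsto_const_div_atTop_nhds_zero_nat ((4 * (q + 2) : ℕ) : ℝ)).add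
      (tendsto_const_div_atTop_nhds_zero_nat (10 * Real.log (q + 1)))
    have h3 := (h1.const_mul ((q + 3 : ℕ) : ℝ)).add h2
    simp only [mul_zero, add_zero] at h3
    refine h3.congr fun D => ?_
    ring
  -- D is fixed before m: half of δ pays for the exponents, the other half for the factor (q + 1) *
  -- D.
  obtain ⟨D, hDlt, hD⟩ := ((hlim.eventually (gt_mem_nhds (half_pos hδ))).and
    (eventually_gt_atTop 0)).exists
  have hconst : ∀ᶠ m : ℕ in atTop, (((q + 1) * D : ℕ) : ℝ) ≤ Real.exp (δ / 2 * m) :=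
    (Real.tendsto_exp_atTop.comp (tendsto_natCast_atTop_atTop.const_mul_atTop
      (half_pos hδ))).eventually_ge_atTop _
  filter_upwards [hconst, eventually_ge_atTop ((q + 1) * D ^ 4 + D)] with m h1 h2
  have hc : 0 < cConst q := by linarith [two_le_cConst hq]
  refine (Nat.cast_le.2 (mult_le_ncard_kunzWords q m)).trans
    ((ncard_kunzWords_le hq hD h2).trans ?_)
  calc _ ≤ Real.exp (δ / 2 * m) *
        Real.exp (m * (((q + 3 : ℕ) * Real.log D + (4 * (q + 2) : ℕ)) / D)) *
        (cConst q ^ m * Real.exp (m * (10 * Real.log (q + 1) / D))) := by gcongr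
    _ = cConst q ^ m * Real.exp (δ / 2 * m + m * ((((q + 3 : ℕ) * Real.log D +
          (4 * (q + 2) : ℕ)) / D) + 10 * Real.log (q + 1) / D)) := by
        rw [Real.exp_add, mul_add (m : ℝ), Real.exp_add]; ring
    _ ≤ cConst q ^ m * Real.exp (δ / 2 * m + m * (δ / 2)) := by gcongr
    _ = _ := by
        congr 2; ring

theorem mainTheorem4 (q : ℕ) (hq : 2 ≤ q) :
    (∀ m : ℕ, (depthMultSet q m).Finite) ∧
      ∃ ε : ℕ → ℝ,
        Asymptotics.IsLittleO Filter.atTop ε (fun m : ℕ => (m : ℝ)) ∧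
          ∀ᶠ m : ℕ in Filter.atTop,
            (Mult q m : ℝ) = cConst q ^ ((m : ℝ) + ε m) := by
  have hc2 := two_le_cConst hq
  have hc : 0 < cConst q := by linarith
  have hlc : 0 < Real.log (cConst q) := Real.log_pos (by linarith)
  have hpos : ∀ m : ℕ, 2 ≤ m → 0 < (Mult q m : ℝ) := fun m hm =>
    (Real.rpow_pos_of_pos hc _).trans_le (cConst_rpow_le_mult hq hm)
  refine ⟨depthMultSet_finite q, fun m => Real.log (Mult q m) / Real.log (cConst q) - m, ?_, ?_⟩
  · refine Asymptotics.isLittleO_iff.2 fun η hη => ?_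
    have hlarge : ∀ᶠ m : ℕ in Filter.atTop, 3 ≤ η * (m : ℝ) :=
      (tendsto_natCast_atTop_atTop.const_mul_atTop hη).eventually_ge_atTop _
    filter_upwards [eventually_mult_le hq (mul_pos hη hlc), hlarge, Filter.eventually_ge_atTop 2]
      with m hup hbig hm
    have h1 := Real.log_le_log (hpos m hm) hup
    have h2 := Real.log_le_log (Real.rpow_pos_of_pos hc _) (cConst_rpow_le_mult hq hm)
    rw [Real.log_mul (by positivity) (by positivity), Real.log_pow, Real.log_exp] at h1
    rw [Real.log_rpow hc] at h2
    rw [Real.norm_eq_abs, Real.norm_eq_abs, abs_of_nonneg (Nat.cast_nonneg m : (0 : ℝ) ≤ m), abs_le]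
    constructor
    · have : (m : ℝ) - 3 ≤ Real.log (Mult q m) / Real.log (cConst q) := (le_div_iff₀ hlc).2 h2
      linarith
    · have : Real.log (Mult q m) / Real.log (cConst q) ≤ m + η * m :=
        (div_le_iff₀ hlc).2 (by linarith)
      linarith
  · filter_upwards [Filter.eventually_ge_atTop 2] with m hm
    rw [add_sub_cancel, Real.rpow_def_of_pos hc, mul_div_cancel₀ _ hlc.ne', Real.exp_log (hpos m hm)]
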